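/- Let $K$ be a compact Hausdorff space and let $d\colon K\times K\to[0,+\infty)$ be a metric on $K$ that is lower semicontinuous as a function on $K\times K$ (with the product of the compact topology). If the topology generated by $d$ is strictly finer than the given compact topology of $K$, then the Banach space $C(K)$ of real-valued continuous functions on $K$ (for the compact topology), with the supremum norm, contains a Lipschitz subspace isometric to $c_0$; that is, there is a linear subspace $X\subset C(K)$ such that every $f\in X$ is Lipschitz with respect to $d$, and $X$ with the supremum norm is linearly isometric to the Banach space $c_0$ of real sequences converging to $0$ with the supremum norm. -/

import Mathlib

open scoped ZeroAtInfty NNReal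

namespace LipSub

/-- The topology on `K` generated by the metric `d`. -/
abbrev metricTopology {K : Type*} (d : MetricSpace K) : TopologicalSpace K :=
  d.toPseudoMetricSpace.toUniformSpace.toTopologicalSpace

/-- The metric `d`, as a real function on `K × K`, is lower semicontinuous for the product of the
topology `τ` with itself. -/
def IsLscMetric {K : Type*} (τ : TopologicalSpace K) (d : MetricSpace K) : Prop :=
  @LowerSemicontinuous (K × K) ℝ (@instTopologicalSpaceProd K K τ τ) _
    (fun p : K × K => d.dist p.1 p.2)

/-- `f` is Lipschitz with respect to the metric `d`. -/
def IsLip {K : Type*} (d : MetricSpace K) (f : K → ℝ) : Prop :=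
  ∃ L : ℝ≥0, LipschitzWith L f

/-- A linear subspace of `C(K)` (continuity refers to the topology of `K`) is a Lipschitz subspace
if all its elements are Lipschitz with respect to `d`. -/
def IsLipschitzSubspace {K : Type*} (d : MetricSpace K) [τ : TopologicalSpace K]
    (X : Submodule ℝ (@ContinuousMap K ℝ τ _)) : Prop :=
  ∀ f ∈ X, IsLip d f

end LipSub

/-! Some `d`-ball of radius `r` about a point `x` is not a neighbourhood of `x`, so every
neighbourhood of `x` contains points at `d`-distance at least `r` from it. `exists_disjoint_bumps`
puts peaks at such points inductively, using a Urysohn lemma whose functions are both continuous and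
`d`-Lipschitz (`exists_continuous_lipschitz_zero_one`). The bumps have height one, disjoint supports
and a common Lipschitz constant, so `a ↦ ∑ aₖ gₖ` embeds `c₀` isometrically with Lipschitz image. -/

namespace LipSub

/-! ### Lipschitz Urysohn lemma and disjoint bumps -/

section Urysohn

variable {K : Type*} [TopologicalSpace K]

/-- The closed `r`-enlargement of `C` with respect to `ρ`. -/
def enlargement (ρ : K → K → ℝ) (C : Set K) (r : ℝ) : Set K :=
  {y | ∃ c ∈ C, ρ c y ≤ r}

lemma isClosed_enlargement [CompactSpace K] {ρ : K → K → ℝ}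
    (hρ : ∀ r, IsClosed {p : K × K | ρ p.1 p.2 ≤ r}) {C : Set K} (hC : IsClosed C) (r : ℝ) :
    IsClosed (enlargement ρ C r) := by
  have h : enlargement ρ C r
      = Prod.snd '' ((Prod.fst ⁻¹' C) ∩ {p : K × K | ρ p.1 p.2 ≤ r}) := by
    ext y
    constructor
    · rintro ⟨c, hc, h⟩
      exact ⟨(c, y), ⟨hc, h⟩, rfl⟩
    · rintro ⟨⟨c, y'⟩, ⟨hc, h⟩, rfl⟩
      exact ⟨c, hc, h⟩
  rw [h]
  exact isClosedMap_snd_of_compactSpace _ ((hC.preimage continuous_fst).inter (hρ r))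

/-- A family of cuts `(t, C, D)`, with `C` and `D` closed sets covering `K`, such that `C` at level
`s` and `D` at level `t > s` are at distance more than `δ * (t - s)`. -/
structure IsCutFamily (ρ : K → K → ℝ) (δ : ℝ) (S : Set (ℝ × Set K × Set K)) : Prop where
  isClosed_left : ∀ p ∈ S, IsClosed p.2.1
  isClosed_right : ∀ p ∈ S, IsClosed p.2.2
  cover : ∀ p ∈ S, ∀ x, x ∈ p.2.1 ∨ x ∈ p.2.2
  sep : ∀ p ∈ S, ∀ q ∈ S, p.1 < q.1 → ∀ x ∈ p.2.1, ∀ y ∈ q.2.2, δ * (q.1 - p.1) < ρ x y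

/-- A cut at any prescribed level can be added to a finite family of cuts. -/
lemma IsCutFamily.exists_insert [CompactSpace K] [T2Space K] {ρ : K → K → ℝ}
    (hsymm : ∀ x y, ρ x y = ρ y x) (htri : ∀ x y z, ρ x z ≤ ρ x y + ρ y z)
    (hρ : ∀ r, IsClosed {p : K × K | ρ p.1 p.2 ≤ r}) {δ : ℝ} {S : Set (ℝ × Set K × Set K)}
    (hS : IsCutFamily ρ δ S) (hfin : S.Finite) (t : ℝ) :
    ∃ c : Set K × Set K, IsCutFamily ρ δ (insert (t, c) S) := by
  -- The new right set must avoid `L` and the new left set must avoid `M`. A common point would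
  -- violate `sep` by the triangle inequality; finiteness of `S` keeps both unions closed.
  set L : Set K := ⋃ p ∈ {p ∈ S | p.1 < t}, enlargement ρ p.2.1 (δ * (t - p.1)) with hL
  set M : Set K := ⋃ p ∈ {p ∈ S | t < p.1}, enlargement ρ p.2.2 (δ * (p.1 - t)) with hM
  have hLc : IsClosed L := (hfin.subset (Set.sep_subset _ _)).isClosed_biUnion fun p hp =>
    isClosed_enlargement hρ (hS.isClosed_left p hp.1) _
  have hMc : IsClosed M := (hfin.subset (Set.sep_subset _ _)).isClosed_biUnion fun p hp =>
    isClosed_enlargement hρ (hS.isClosed_right p hp.1) _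
  have hdisj : Disjoint L M := by
    rw [Set.disjoint_left]
    intro z hzL hzM
    simp only [hL, hM, Set.mem_iUnion, exists_prop] at hzL hzM
    obtain ⟨p, ⟨hp, hpt⟩, x, hx, hxz⟩ := hzL
    obtain ⟨q, ⟨hq, hqt⟩, y, hy, hyz⟩ := hzM
    have h1 := hS.sep p hp q hq (hpt.trans hqt) x hx y hy
    have h2 := htri x z y
    rw [hsymm z y] at h2
    nlinarith
  obtain ⟨G, H, hG, hH, hLG, hMH, hGH⟩ := normal_separation hLc hMc hdisj
  refine ⟨(Hᶜ, Gᶜ), ?_, ?_, ?_, ?_⟩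
  · rintro p (rfl | hp)
    · exact hH.isClosed_compl
    · exact hS.isClosed_left p hp
  · rintro p (rfl | hp)
    · exact hG.isClosed_compl
    · exact hS.isClosed_right p hp
  · rintro p (rfl | hp) x
    · by_cases hx : x ∈ H
      · exact Or.inr fun hxG => Set.disjoint_left.1 hGH hxG hx
      · exact Or.inl hx
    · exact hS.cover p hp x
  · rintro p (rfl | hp) q (rfl | hq) hpq x hx y hy
    · exact absurd hpq (lt_irrefl _)
    · by_contra! hle
      refine hx (hMH ?_)
      simp only [hM, Set.mem_iUnion, exists_prop]
      exact ⟨q, ⟨hq, hpq⟩, y, hy, by rwa [hsymm]⟩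
    · by_contra! hle
      refine hy (hLG ?_)
      simp only [hL, Set.mem_iUnion, exists_prop]
      exact ⟨p, ⟨hp, hpq⟩, x, hx, hle⟩
    · exact hS.sep p hp q hq hpq x hx y hy

/-- A finite family of cuts extends to a family with a dense set of levels. -/
lemma IsCutFamily.exists_dense [CompactSpace K] [T2Space K] {ρ : K → K → ℝ}
    (hsymm : ∀ x y, ρ x y = ρ y x) (htri : ∀ x y z, ρ x z ≤ ρ x y + ρ y z)
    (hρ : ∀ r, IsClosed {p : K × K | ρ p.1 p.2 ≤ r}) {δ : ℝ} {S : Set (ℝ × Set K × Set K)}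
    (hS : IsCutFamily ρ δ S) (hfin : S.Finite) :
    ∃ S', S ⊆ S' ∧ IsCutFamily ρ δ S' ∧ ∀ a b : ℝ, a < b → ∃ p ∈ S', a < p.1 ∧ p.1 < b := by
  let F := {T : Set (ℝ × Set K × Set K) // IsCutFamily ρ δ T ∧ T.Finite}
  have step : ∀ (n : ℕ) (T : F), ∃ T' : F, T.1 ⊆ T'.1 ∧
      ∃ p ∈ T'.1, p.1 = TopologicalSpace.denseSeq ℝ n := by
    intro n T
    obtain ⟨c, hc⟩ := T.2.1.exists_insert hsymm htri hρ T.2.2 (TopologicalSpace.denseSeq ℝ n)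
    exact ⟨⟨_, hc, T.2.2.insert _⟩, Set.subset_insert _ _, _, Set.mem_insert _ _, rfl⟩
  choose next hsub hlev using step
  let T : ℕ → F := fun n => Nat.rec ⟨S, hS, hfin⟩ (fun n T => next n T) n
  have hmono : Monotone fun n => (T n).1 := monotone_nat_of_le_succ fun n => hsub n (T n)
  refine ⟨⋃ n, (T n).1, Set.subset_iUnion (fun n => (T n).1) 0, ⟨?_, ?_, ?_, ?_⟩, ?_⟩
  · intro p hp
    obtain ⟨n, hn⟩ := Set.mem_iUnion.1 hp
    exact (T n).2.1.isClosed_left p hn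
  · intro p hp
    obtain ⟨n, hn⟩ := Set.mem_iUnion.1 hp
    exact (T n).2.1.isClosed_right p hn
  · intro p hp
    obtain ⟨n, hn⟩ := Set.mem_iUnion.1 hp
    exact (T n).2.1.cover p hn
  · intro p hp q hq
    obtain ⟨n, hn⟩ := Set.mem_iUnion.1 hp
    obtain ⟨m, hm⟩ := Set.mem_iUnion.1 hq
    exact (T (max n m)).2.1.sep p (hmono (le_max_left n m) hn) q (hmono (le_max_right n m) hm)
  · intro a b hab
    obtain ⟨_, ⟨n, rfl⟩, h⟩ := (TopologicalSpace.denseRange_denseSeq ℝ).exists_between hab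
    obtain ⟨p, hp, hpn⟩ := hlev n (T n)
    exact ⟨p, Set.mem_iUnion.2 ⟨n + 1, hp⟩, by rw [hpn]; exact h⟩

/-- Urysohn's lemma for a lower semicontinuous metric: closed sets at distance more than `δ` are
separated by a continuous function satisfying a Lipschitz condition with constant `δ⁻¹`. -/
theorem exists_continuous_lipschitz_zero_one [CompactSpace K] [T2Space K] {ρ : K → K → ℝ}
    (hself : ∀ x, ρ x x = 0) (hsymm : ∀ x y, ρ x y = ρ y x)
    (htri : ∀ x y z, ρ x z ≤ ρ x y + ρ y z)
    (hρ : ∀ r, IsClosed {p : K × K | ρ p.1 p.2 ≤ r}) {δ : ℝ} (hδ : 0 < δ) {A B : Set K}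
    (hA : IsClosed A) (hB : IsClosed B) (hAB : ∀ x ∈ A, ∀ y ∈ B, δ < ρ x y) :
    ∃ f : C(K, ℝ), (∀ x ∈ A, f x = 0) ∧ (∀ x ∈ B, f x = 1) ∧ (∀ x, 0 ≤ f x) ∧ (∀ x, f x ≤ 1) ∧
      ∀ x y, |f x - f y| ≤ δ⁻¹ * ρ x y := by
  have hbase : IsCutFamily ρ δ
      ({(0, A, Set.univ), (1, Set.univ, B)} : Set (ℝ × Set K × Set K)) := by
    constructor
    · rintro p (rfl | rfl)
      exacts [hA, isClosed_univ]
    · rintro p (rfl | rfl)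
      exacts [isClosed_univ, hB]
    · rintro p (rfl | rfl) x <;> simp
    · rintro p (rfl | rfl) q (rfl | rfl) hpq x hx y hy
      · exact absurd hpq (lt_irrefl _)
      · simpa using hAB x hx y hy
      · norm_num at hpq
      · exact absurd hpq (lt_irrefl _)
  obtain ⟨S, hsub, hS, hdense⟩ := hbase.exists_dense hsymm htri hρ (Set.toFinite _)
  have h0 : ((0, A, Set.univ) : ℝ × Set K × Set K) ∈ S := hsub (by simp)
  have h1 : ((1, Set.univ, B) : ℝ × Set K × Set K) ∈ S := hsub (by simp)
  have hle : ∀ p ∈ S, ∀ q ∈ S, ∀ x, x ∈ p.2.2 → x ∈ q.2.1 → p.1 ≤ q.1 := by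
    intro p hp q hq x hxp hxq
    by_contra! hlt
    have := hS.sep q hq p hp hlt x hxq x hxp
    rw [hself] at this
    nlinarith
  -- In a cut `(t, C, D)`, `C` plays the role of `{f ≤ t}` and `D` of `{t ≤ f}`.
  let V : K → Set ℝ := fun x => {t | ∃ p ∈ S, x ∈ p.2.1 ∧ p.1 = t}
  have hne : ∀ x, (V x).Nonempty := fun x => ⟨1, _, h1, Set.mem_univ x, rfl⟩
  have hbdd : ∀ x, BddBelow (V x) := by
    intro x
    refine ⟨0, ?_⟩
    rintro _ ⟨p, hp, hx, rfl⟩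
    exact hle _ h0 p hp x (Set.mem_univ x) hx
  let f : K → ℝ := fun x => sInf (V x)
  have hfle : ∀ p ∈ S, ∀ x ∈ p.2.1, f x ≤ p.1 := fun p hp x hx =>
    csInf_le (hbdd x) ⟨p, hp, hx, rfl⟩
  have hlef : ∀ p ∈ S, ∀ x ∈ p.2.2, p.1 ≤ f x := by
    intro p hp x hx
    refine le_csInf (hne x) ?_
    rintro _ ⟨q, hq, hxq, rfl⟩
    exact hle p hp q hq x hx hxq
  have hnonneg : ∀ x, 0 ≤ f x := fun x => hlef _ h0 x (Set.mem_univ x)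
  have hone : ∀ x, f x ≤ 1 := fun x => hfle _ h1 x (Set.mem_univ x)
  have hcont : Continuous f := by
    rw [continuous_iff_continuousAt]
    intro x
    refine tendsto_order.2 ⟨fun a ha => ?_, fun a ha => ?_⟩
    · obtain ⟨p, hp, hap, hpx⟩ := hdense a (f x) ha
      have hx : x ∈ p.2.1ᶜ := fun hx => (hfle p hp x hx).not_gt hpx
      filter_upwards [(hS.isClosed_left p hp).isOpen_compl.mem_nhds hx] with y hy
      exact hap.trans_le (hlef p hp y ((hS.cover p hp y).resolve_left hy))
    · obtain ⟨p, hp, hxp, hpa⟩ := hdense (f x) a ha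
      have hx : x ∈ p.2.2ᶜ := fun hx => (hlef p hp x hx).not_gt hxp
      filter_upwards [(hS.isClosed_right p hp).isOpen_compl.mem_nhds hx] with y hy
      exact (hfle p hp y ((hS.cover p hp y).resolve_right hy)).trans_lt hpa
  have hlip : ∀ x y, f y - f x ≤ δ⁻¹ * ρ x y := by
    intro x y
    by_contra! hlt
    have hnn : 0 ≤ ρ x y := by
      have := htri x y x
      rw [hself, hsymm y x] at this
      linarith
    have hnn' : 0 ≤ δ⁻¹ * ρ x y := by positivity
    -- Giving up half of the excess at each end leaves levels more than `δ⁻¹ * ρ x y` apart.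
    obtain ⟨p, hp, hxp, hpa⟩ := hdense (f x) (f x + (f y - f x - δ⁻¹ * ρ x y) / 2) (by linarith)
    obtain ⟨q, hq, haq, hqy⟩ := hdense (f y - (f y - f x - δ⁻¹ * ρ x y) / 2) (f y) (by linarith)
    have hx : x ∈ p.2.1 := (hS.cover p hp x).resolve_right fun h => (hlef p hp x h).not_gt hxp
    have hy : y ∈ q.2.2 := (hS.cover q hq y).resolve_left fun h => (hfle q hq y h).not_gt hqy
    have hsep := hS.sep p hp q hq (by linarith) x hx y hy
    have hδρ : δ * (δ⁻¹ * ρ x y) = ρ x y := by field_simp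
    have : δ * (δ⁻¹ * ρ x y) < δ * (q.1 - p.1) := mul_lt_mul_of_pos_left (by linarith) hδ
    linarith
  refine ⟨⟨f, hcont⟩, fun x hx => le_antisymm (hfle _ h0 x hx) (hnonneg x),
    fun x hx => le_antisymm (hone x) (hlef _ h1 x hx), hnonneg, hone, fun x y => ?_⟩
  rw [abs_le]
  have e1 := hlip x y
  have e2 := hlip y x
  rw [hsymm y x] at e2
  simp only [ContinuousMap.coe_mk]
  constructor <;> linarith

/-- If some ball of a lower semicontinuous metric is not a neighbourhood of its centre, there is a
uniformly Lipschitz sequence of disjointly supported bump functions of height one. -/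
theorem exists_disjoint_bumps [CompactSpace K] [T2Space K] {ρ : K → K → ℝ}
    (hself : ∀ x, ρ x x = 0) (hsymm : ∀ x y, ρ x y = ρ y x)
    (htri : ∀ x y z, ρ x z ≤ ρ x y + ρ y z)
    (hρ : ∀ r, IsClosed {p : K × K | ρ p.1 p.2 ≤ r}) {r : ℝ} (hr : 0 < r) {x : K}
    (hx : {y | ρ y x < r} ∉ nhds x) :
    ∃ (L : ℝ) (g : ℕ → C(K, ℝ)), 0 ≤ L ∧ (∀ n y, 0 ≤ g n y) ∧ (∀ n y, g n y ≤ 1) ∧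
      (∀ n, ∃ y, g n y = 1) ∧ (∀ n y z, |g n y - g n z| ≤ L * ρ y z) ∧
      ∀ m n, m ≠ n → ∀ y, g m y = 0 ∨ g n y = 0 := by
  -- The last clause keeps room for later peaks: near `x`, whole balls of radius `r / 4` lie in the
  -- zero set of `f`.
  let P : C(K, ℝ) → Prop := fun f => (∀ y, f y ≤ 1) ∧ (∃ y, f y = 1) ∧
    (∀ y z, |f y - f z| ≤ (r / 4)⁻¹ * ρ y z) ∧
    ∃ U ∈ nhds x, ∀ u ∈ U, ∀ y, ρ u y ≤ r / 4 → f y = 0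
  have hstep : ∀ s : Finset C(K, ℝ), (∀ f ∈ s, P f) →
      ∃ g, P g ∧ ∀ f ∈ s, ∀ y, 1 / 2 ≤ f y → g y = 0 := by
    intro s hs
    have hU0 : ∀ᶠ u in nhds x, ∀ f ∈ s, ∀ y, ρ u y ≤ r / 4 → f y = 0 := by
      rw [Filter.eventually_all_finset]
      intro f hf
      obtain ⟨U, hU, h⟩ := (hs f hf).2.2.2
      exact Filter.mem_of_superset hU h
    obtain ⟨x', hx'U, hx'r⟩ : ∃ x', (∀ f ∈ s, ∀ y, ρ x' y ≤ r / 4 → f y = 0) ∧ r ≤ ρ x' x := by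
      by_contra! hcon
      exact hx (hU0.mono hcon)
    have hopen : {y | r / 2 < ρ x' y} ∈ nhds x := by
      have hcl : IsClosed {y | ρ x' y ≤ r / 2} :=
        (hρ (r / 2)).preimage (Continuous.prodMk_right x')
      have := hcl.isOpen_compl.mem_nhds (x := x) (by
        simp only [Set.mem_compl_iff, Set.mem_ofPred_eq]; linarith)
      filter_upwards [this] with y hy
      simpa using hy
    obtain ⟨U, hU, hUc, hUsub⟩ := exists_mem_nhds_isClosed_subset hopen
    -- `U` is more than `r / 2` from `x'`, so its enlargement is still more than `r / 4` away. The
    -- sets `{1 / 2 ≤ f}` are closed, unlike `{f ≠ 0}`; truncating at `1 / 2` later makes the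
    -- supports disjoint.
    let A : Set K := enlargement ρ U (r / 4) ∪ ⋃ f ∈ s, {y | 1 / 2 ≤ f y}
    have hA : IsClosed A := (isClosed_enlargement hρ hUc _).union
      (s.finite_toSet.isClosed_biUnion fun f _ => isClosed_le continuous_const f.continuous)
    have hsep : ∀ a ∈ A, ∀ b ∈ ({x'} : Set K), r / 4 < ρ a b := by
      intro a ha b hb
      rw [Set.mem_singleton_iff.1 hb]
      rcases ha with ⟨u, hu, hua⟩ | ha
      · have h1 : r / 2 < ρ x' u := hUsub hu
        have h2 := htri x' a u
        rw [hsymm a u] at h2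
        rw [hsymm]
        linarith
      · simp only [Set.mem_iUnion, exists_prop] at ha
        obtain ⟨f, hf, hfa⟩ := ha
        by_contra! hle
        rw [hsymm] at hle
        have h3 : (1 / 2 : ℝ) ≤ f a := hfa
        rw [hx'U f hf a hle] at h3
        norm_num at h3
    obtain ⟨g, hgA, hgB, -, hg1, hglip⟩ := exists_continuous_lipschitz_zero_one hself hsymm htri hρ
      (by positivity : 0 < r / 4) hA isClosed_singleton hsep
    refine ⟨g, ⟨hg1, ⟨x', hgB x' rfl⟩, hglip, U, hU, fun u hu y huy =>
      hgA y (Or.inl ⟨u, hu, huy⟩)⟩, fun f hf y hy => hgA y (Or.inr ?_)⟩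
    simp only [Set.mem_iUnion, exists_prop]
    exact ⟨f, hf, hy⟩
  obtain ⟨f, hfP, hfr⟩ := exists_seq_of_forall_finset_exists P
    (fun f g => ∀ y, 1 / 2 ≤ f y → g y = 0) hstep
  have hdisj : ∀ m n, m < n → ∀ y,
      max (2 * f m y - 1) 0 = 0 ∨ max (2 * f n y - 1) 0 = 0 := by
    intro m n hmn y
    rcases le_total (1 / 2) (f m y) with h | h
    · right
      rw [hfr m n hmn y h]
      norm_num
    · left
      exact max_eq_right (by linarith)
  refine ⟨2 * (r / 4)⁻¹, fun n => ⟨fun y => max (2 * f n y - 1) 0, by fun_prop⟩, by positivity,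
    fun n y => le_max_right _ _, fun n y => ?_, fun n => ?_, fun n y z => ?_, fun m n hmn y => ?_⟩
  · exact max_le (by linarith [(hfP n).1 y]) zero_le_one
  · obtain ⟨y, hy⟩ := (hfP n).2.1
    exact ⟨y, by simp only [ContinuousMap.coe_mk, hy]; norm_num⟩
  · have h := (hfP n).2.2.1 y z
    refine (abs_max_sub_max_le_abs _ _ _).trans ?_
    have e : 2 * f n y - 1 - (2 * f n z - 1) = 2 * (f n y - f n z) := by ring
    rw [e, abs_mul, abs_two]
    linarith
  · rcases lt_or_gt_of_ne hmn with h | h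
    · exact hdisj m n h y
    · exact (hdisj n m h y).symm

end Urysohn

/-! ### Embedding `c₀` by disjoint bumps -/

section Embedding

variable {K : Type*} [TopologicalSpace K] {g : ℕ → C(K, ℝ)}

lemma exists_forall_ne_eq_zero (hdisj : ∀ m n, m ≠ n → ∀ y, g m y = 0 ∨ g n y = 0) (y : K) :
    ∃ n, ∀ k, k ≠ n → g k y = 0 := by
  by_cases h : ∃ n, g n y ≠ 0
  · obtain ⟨n, hn⟩ := h
    exact ⟨n, fun k hk => (hdisj k n hk y).resolve_right hn⟩
  · push Not at h
    exact ⟨0, fun k _ => h k⟩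

lemma tsum_mul_eq_of_forall_ne {y : K} {n : ℕ} (hn : ∀ k, k ≠ n → g k y = 0) (a : ℕ → ℝ) :
    ∑' k, a k * g k y = a n * g n y :=
  tsum_eq_single n fun k hk => by rw [hn k hk, mul_zero]

/-- Since `a` tends to zero and at most one term is nonzero at each point, the finite partial sums
converge uniformly. -/
lemma continuous_tsum_disjoint (h0 : ∀ n y, 0 ≤ g n y) (h1 : ∀ n y, g n y ≤ 1)
    (hdisj : ∀ m n, m ≠ n → ∀ y, g m y = 0 ∨ g n y = 0) (a : C₀(ℕ, ℝ)) :
    Continuous fun y => ∑' k, a k * g k y := by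
  refine continuous_of_uniform_approx_of_continuous fun u hu => ?_
  obtain ⟨ε, hε, hεu⟩ := Metric.mem_uniformity_dist.1 hu
  have ha : Filter.Tendsto a Filter.atTop (nhds 0) := by
    have := a.zero_at_infty'
    rwa [Filter.cocompact_eq_cofinite, Nat.cofinite_eq_atTop] at this
  obtain ⟨N, hN⟩ := Metric.tendsto_atTop.1 ha ε hε
  refine ⟨fun y => ∑ k ∈ Finset.range N, a k * g k y, by fun_prop, fun y => hεu ?_⟩
  obtain ⟨n, hn⟩ := exists_forall_ne_eq_zero hdisj y
  rw [tsum_mul_eq_of_forall_ne hn]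
  beta_reduce
  by_cases hnN : n < N
  · rw [Finset.sum_eq_single n (fun k _ hk => by rw [hn k hk, mul_zero])
      (fun h => absurd (Finset.mem_range.2 hnN) h), dist_self]
    exact hε
  · rw [Finset.sum_eq_zero fun k hk => by
      rw [hn k (by have := Finset.mem_range.1 hk; omega), mul_zero], dist_zero_right, norm_mul]
    have e1 := hN n (by omega)
    rw [dist_zero_right] at e1
    have e2 : ‖g n y‖ ≤ 1 := by
      rw [Real.norm_eq_abs, abs_of_nonneg (h0 n y)]
      exact h1 n y
    nlinarith [norm_nonneg (a n), norm_nonneg (g n y)]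

/-- Disjointly supported functions with values in `[0, 1]` that attain the value `1` span an
isometric copy of `c₀`. -/
noncomputable def c0Embedding [CompactSpace K] (h0 : ∀ n y, 0 ≤ g n y) (h1 : ∀ n y, g n y ≤ 1)
    (hatt : ∀ n, ∃ y, g n y = 1) (hdisj : ∀ m n, m ≠ n → ∀ y, g m y = 0 ∨ g n y = 0) :
    C₀(ℕ, ℝ) →ₗᵢ[ℝ] C(K, ℝ) where
  toFun a := ⟨fun y => ∑' k, a k * g k y, continuous_tsum_disjoint h0 h1 hdisj a⟩
  map_add' a b := by
    ext y
    obtain ⟨n, hn⟩ := exists_forall_ne_eq_zero hdisj y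
    simp only [ContinuousMap.coe_mk, ContinuousMap.add_apply, tsum_mul_eq_of_forall_ne hn,
      ZeroAtInftyContinuousMap.coe_add, Pi.add_apply]
    ring
  map_smul' c a := by
    ext y
    obtain ⟨n, hn⟩ := exists_forall_ne_eq_zero hdisj y
    simp only [ContinuousMap.coe_mk, ContinuousMap.smul_apply, tsum_mul_eq_of_forall_ne hn,
      ZeroAtInftyContinuousMap.coe_smul, Pi.smul_apply, smul_eq_mul, RingHom.id_apply]
    ring
  norm_map' a := by
    have hcoord : ∀ n, ‖a n‖ ≤ ‖a‖ := fun n => by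
      rw [← ZeroAtInftyContinuousMap.norm_toBCF_eq_norm]
      exact a.toBCF.norm_coe_le_norm n
    refine le_antisymm ?_ ?_
    · refine (ContinuousMap.norm_le _ (norm_nonneg a)).2 fun y => ?_
      obtain ⟨n, hn⟩ := exists_forall_ne_eq_zero hdisj y
      change ‖∑' k, a k * g k y‖ ≤ ‖a‖
      rw [tsum_mul_eq_of_forall_ne hn, norm_mul, Real.norm_eq_abs (g n y), abs_of_nonneg (h0 n y)]
      exact (mul_le_of_le_one_right (norm_nonneg _) (h1 n y)).trans (hcoord n)
    · rw [← ZeroAtInftyContinuousMap.norm_toBCF_eq_norm]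
      refine (BoundedContinuousFunction.norm_le (norm_nonneg _)).2 fun n => ?_
      obtain ⟨y, hy⟩ := hatt n
      have hn : ∀ k, k ≠ n → g k y = 0 := fun k hk =>
        (hdisj k n hk y).resolve_right (by rw [hy]; exact one_ne_zero)
      refine le_trans (le_of_eq ?_) (ContinuousMap.norm_coe_le_norm _ y)
      change ‖a n‖ = ‖∑' k, a k * g k y‖
      rw [tsum_mul_eq_of_forall_ne hn, hy, mul_one]

/-- Only one index is active at `y` and one at `z`; each contributes at most `M * L * ρ y z`, whence
the factor 2. -/
lemma abs_tsum_sub_tsum_le {ρ : K → K → ℝ} {L : ℝ}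
    (hlip : ∀ n y z, |g n y - g n z| ≤ L * ρ y z)
    (hdisj : ∀ m n, m ≠ n → ∀ y, g m y = 0 ∨ g n y = 0) {a : ℕ → ℝ} {M : ℝ}
    (ha : ∀ n, |a n| ≤ M) (y z : K) :
    |∑' k, a k * g k y - ∑' k, a k * g k z| ≤ 2 * M * L * ρ y z := by
  obtain ⟨n, hn⟩ := exists_forall_ne_eq_zero hdisj y
  obtain ⟨m, hm⟩ := exists_forall_ne_eq_zero hdisj z
  have hM : 0 ≤ M := (abs_nonneg _).trans (ha 0)
  have hterm : ∀ k, |a k * (g k y - g k z)| ≤ M * (L * ρ y z) := fun k => by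
    rw [abs_mul]
    exact mul_le_mul (ha k) (hlip k y z) (abs_nonneg _) hM
  rw [tsum_mul_eq_of_forall_ne hn, tsum_mul_eq_of_forall_ne hm]
  by_cases hnm : n = m
  · subst hnm
    rw [← mul_sub]
    have := hterm n
    linarith [(abs_nonneg _).trans this]
  · have e : a n * g n y - a m * g m z = a n * (g n y - g n z) + a m * (g m y - g m z) := by
      rw [hm n hnm, hn m (Ne.symm hnm)]
      ring
    rw [e]
    linarith [abs_add_le (a n * (g n y - g n z)) (a m * (g m y - g m z)), hterm n, hterm m]

end Embedding

/-- If a metric topology is strictly finer than `τ`, some ball is not a `τ`-neighbourhood of its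
centre. -/
lemma exists_ball_notMem_nhds {K : Type*} (d : MetricSpace K) (τ : TopologicalSpace K)
    (h : metricTopology d < τ) :
    ∃ (x : K) (r : ℝ), 0 < r ∧ {y | d.dist y x < r} ∉ @nhds K τ x := by
  by_contra! hcon
  refine h.not_ge fun O hO => ?_
  refine (@isOpen_iff_mem_nhds K τ O).2 fun x hx => ?_
  obtain ⟨r, hr, hsub⟩ := (@Metric.isOpen_iff K d.toPseudoMetricSpace O).1 hO x hx
  exact Filter.mem_of_superset (hcon x r hr) hsub

end LipSub

theorem theorem4p2 {K : Type*} (d : MetricSpace K) [τ : TopologicalSpace K]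
    [@CompactSpace K τ] [@T2Space K τ]
    (hlsc : LipSub.IsLscMetric τ d)
    (hfiner : LipSub.metricTopology d < τ) :
    ∃ X : Submodule ℝ C(K, ℝ),
      LipSub.IsLipschitzSubspace d X ∧ Nonempty (X ≃ₗᵢ[ℝ] C₀(ℕ, ℝ)) := by
  obtain ⟨x, r, hr, hx⟩ := LipSub.exists_ball_notMem_nhds d τ hfiner
  have hρ : ∀ r : ℝ, IsClosed {p : K × K | d.dist p.1 p.2 ≤ r} := fun r =>
    LowerSemicontinuous.isClosed_preimage hlsc r
  obtain ⟨L, g, hL, h0, h1, hatt, hlip, hdisj⟩ := LipSub.exists_disjoint_bumps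
    (ρ := d.dist) d.dist_self d.dist_comm d.dist_triangle hρ hr hx
  refine ⟨LinearMap.range (LipSub.c0Embedding h0 h1 hatt hdisj).toLinearMap, ?_,
    ⟨(LipSub.c0Embedding h0 h1 hatt hdisj).equivRange.symm⟩⟩
  rintro _ ⟨a, rfl⟩
  refine ⟨⟨2 * ‖a‖ * L, by positivity⟩, LipschitzWith.of_dist_le_mul fun y z => ?_⟩
  have ha : ∀ n, |a n| ≤ ‖a‖ := fun n => by
    rw [← ZeroAtInftyContinuousMap.norm_toBCF_eq_norm]
    exact a.toBCF.norm_coe_le_norm n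
  exact LipSub.abs_tsum_sub_tsum_le hlip hdisj ha y z
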